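/- Consider the network game on the path with vertex set $\{1,\dots,n\}$, $n\ge 2$, in which $i$ and $j$ are neighbours iff $|i-j|=1$. Each agent $i$ chooses an activity level $x_i\in[0,1]$, and its best response to $x$ is $f_i(x)=\max\bigl(0,\,1-\delta\sum_{j\sim i}x_j\bigr)$, where $\delta\in[0,1]$. An equilibrium is an $x\in[0,1]^n$ with $x=f(x)$; its active agents are those with $x_i>0$. In the random best-response dynamics, at each time $t=1,2,\dots$ one agent is drawn uniformly at random, independently of the past, and replaces its level by its best response to $x(t-1)$, the other levels being unchanged. An equilibrium $x^*$ is stable if * for every $\varepsilon>0$ there is $r>0$ such that every $x(0)\in[0,1]^n$ with $\|x(0)-x^*\|<r$ satisfies $\mathbb P(\sup_{t>0}\|x(t)-x^*\|<\varepsilon)=1$, and * there is $\varepsilon>0$ such that every $x(0)\in[0,1]^n$ with $\|x(0)-x^*\|<\varepsilon$ satisfies $\mathbb P(\lim_{t\to\infty}\|x(t)-x^*\|=0)=1$. A configuration $a_1-\dots-a_k$ is a finite sequence of positive integers. It supports a stable equilibrium if there is a stable equilibrium on the path whose active set consists of blocks of consecutive agents of sizes $a_1,\dots,a_k$, in this order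 along the path, any two of them separated by at least one inactive agent. Let $\mathbf G(m)$ be the adjacency matrix of the path with $m$ vertices, $\mathbf 1$ the all-ones vector, and $b(\delta,m)$ the activity level of an endpoint agent in the unique equilibrium on the path with $m$ vertices in which all agents are active (when it exists uniquely, which is the case whenever (i) and (ii) hold with $a_i=m$ and $\delta\in[0,1]$). **Theorem.** For every $n\ge 2$ there is a finite set $E\subset\mathbb R$ such that for every $\delta\in[0,1]\setminus E$ and every configuration $a_1-\dots-a_k$: the configuration supports a stable equilibrium on the path with $n$ vertices if and only if the following four conditions hold. (i) For every $i\in\{1,\dots,k\}$ with $a_i\neq 1$, $\delta<-1/\bigl(2\cos(\tfrac{a_i\pi}{a_i+1})\bigr)$. (ii) For every $i\in\{1,\dots,k\}$, all entries of $(\mathbf I+\delta\,\mathbf G(a_i))^{-1}\mathbf 1$ are positive. (iii) For every $i\in\{1,\dots,k-1\}$, $b(\delta,a_i)+b(\delta,a_{i+1})>1/\delta$. (iv) $\sum_{i=1}^k a_i=n-k+1$. -/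

import Mathlib

open MeasureTheory ProbabilityTheory Filter Topology Matrix

noncomputable section

namespace NetworkGame

/-! ### The game with linear best responses

The agents are the elements of `Fin n`, a strategy profile is a vector `x : Fin n → ℝ` with entries
in `[0, 1]`, and `G` is the adjacency matrix of the network. -/

/-- The best response of agent `i` to the activity levels of the other agents. -/
def bestResponse {n : ℕ} (G : Matrix (Fin n) (Fin n) ℝ) (δ : ℝ) (x : Fin n → ℝ) (i : Fin n) : ℝ :=
  max 0 (1 - δ * ∑ j, G i j * x j)

/-- Strategy profiles: every activity level lies in `[0, 1]`. -/
def IsProfile {n : ℕ} (x : Fin n → ℝ) : Prop :=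
  ∀ i, 0 ≤ x i ∧ x i ≤ 1

/-- An equilibrium: a strategy profile in which every agent plays a best response. -/
def IsEquilibrium {n : ℕ} (G : Matrix (Fin n) (Fin n) ℝ) (δ : ℝ) (x : Fin n → ℝ) : Prop :=
  IsProfile x ∧ ∀ i, x i = bestResponse G δ x i

/-! ### Random best-response dynamics -/

/-- The strategy profile after `t` steps when the play starts in `x₀` and the agent who moves in
step `t + 1` is `ω t`. -/
def trajectory {n : ℕ} (G : Matrix (Fin n) (Fin n) ℝ) (δ : ℝ) (x₀ : Fin n → ℝ) (ω : ℕ → Fin n) :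
    ℕ → Fin n → ℝ
  | 0 => x₀
  | t + 1 => Function.update (trajectory G δ x₀ ω t) (ω t)
      (bestResponse G δ (trajectory G δ x₀ ω t) (ω t))

/-- The law of the sequence of moving agents: independent and uniform on the `n` agents
(a probability measure as soon as `n ≠ 0`). -/
def updateLaw (n : ℕ) : Measure (ℕ → Fin n) :=
  Measure.infinitePi fun _ : ℕ => uniformOn (Set.univ : Set (Fin n))

/-- Almost sure Lyapunov stability of `x` (norms are sup norms; the supremum over the times `t > 0`
is taken in `[0, ∞]`). -/
def IsLyapunovStable {n : ℕ} (G : Matrix (Fin n) (Fin n) ℝ) (δ : ℝ) (x : Fin n → ℝ) : Prop :=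
  ∀ ε : ℝ, 0 < ε → ∃ r : ℝ, 0 < r ∧ ∀ x₀ : Fin n → ℝ, IsProfile x₀ → ‖x₀ - x‖ < r →
    updateLaw n {ω | (⨆ t : ℕ, ENNReal.ofReal ‖trajectory G δ x₀ ω (t + 1) - x‖)
      < ENNReal.ofReal ε} = 1

/-- Attractiveness of `x`: almost sure convergence to `x` from all nearby profiles. -/
def IsAttractive {n : ℕ} (G : Matrix (Fin n) (Fin n) ℝ) (δ : ℝ) (x : Fin n → ℝ) : Prop :=
  ∃ ε : ℝ, 0 < ε ∧ ∀ x₀ : Fin n → ℝ, IsProfile x₀ → ‖x₀ - x‖ < ε →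
    updateLaw n {ω | Tendsto (fun t : ℕ => ‖x - trajectory G δ x₀ ω t‖) atTop (𝓝 0)} = 1

/-- A stable equilibrium: an equilibrium that is locally asymptotically stable in probability. -/
def IsStableEquilibrium {n : ℕ} (G : Matrix (Fin n) (Fin n) ℝ) (δ : ℝ) (x : Fin n → ℝ) : Prop :=
  IsEquilibrium G δ x ∧ IsLyapunovStable G δ x ∧ IsAttractive G δ x

/-! ### Path graphs and block configurations -/

instance decidableRelPathGraphAdj (n : ℕ) : DecidableRel (SimpleGraph.pathGraph n).Adj :=
  fun _ _ => decidable_of_iff _ SimpleGraph.pathGraph_adj.symm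

/-- The adjacency matrix of the path graph with `n` vertices. -/
def pathMatrix (n : ℕ) : Matrix (Fin n) (Fin n) ℝ :=
  (SimpleGraph.pathGraph n).adjMatrix ℝ

/-- The active set of the profile `x` on the path consists of blocks of (positive) sizes
`a 0, …, a (k - 1)`, in this order: block `i` is made of the `a i` consecutive agents from position
`s i` on, and two different blocks are separated by at least one inactive agent. -/
def HasConfiguration {n k : ℕ} (a : Fin k → ℕ) (x : Fin n → ℝ) : Prop :=
  ∃ s : Fin k → ℕ,
    (∀ i, s i + a i ≤ n) ∧
    (∀ i j, i < j → s i + a i < s j) ∧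
    ∀ v : Fin n, 0 < x v ↔ ∃ i, s i ≤ (v : ℕ) ∧ (v : ℕ) < s i + a i

/-- The configuration `a` supports a stable equilibrium on the path with `n` vertices. -/
def SupportsStableEquilibrium (n : ℕ) (δ : ℝ) {k : ℕ} (a : Fin k → ℕ) : Prop :=
  ∃ x : Fin n → ℝ, IsStableEquilibrium (pathMatrix n) δ x ∧ HasConfiguration a x

/-- `x` is an equilibrium on the path with `m` vertices in which all agents are active. -/
def IsAllActiveEquilibrium (m : ℕ) (δ : ℝ) (x : Fin m → ℝ) : Prop :=
  IsEquilibrium (pathMatrix m) δ x ∧ ∀ i, 0 < x i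

open Classical in
/-- `b(δ, m)`: the activity level of an endpoint agent in the unique all-active equilibrium on the
path with `m` vertices (both endpoints have the same level, by uniqueness and reflection), with the
value `0` if there is no such unique equilibrium. -/
def endpointActivity (δ : ℝ) (m : ℕ) : ℝ :=
  if h : 0 < m ∧ ∃! x : Fin m → ℝ, IsAllActiveEquilibrium m δ x then h.2.choose ⟨0, h.1⟩ else 0

end NetworkGame

end

namespace NetworkGame

/-! ### Stability and instability criteria for a general network. -/

section Dynamics

variable {n : ℕ}

/-! For `δ < 1` one active neighbour cannot keep an agent inactive, so an inactive agent has two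
active neighbours. Both ends of the path are therefore active and consecutive blocks are separated
by exactly one vertex, which is the count in (iv) (`isTiling_of_equilibrium`). Inside a block the
best responses are linear, so the levels solve `(1 + δG) z = 1`; this gives (ii), and the incentive
of a separating agent to stay inactive is the weak form of (iii).

Stability is decided by comparing `δ` times the largest eigenvalue of each block with 1. Below 1,
the Perron vectors of the blocks provide a weighted sup norm in which best responses contract near
the equilibrium, provided the inactive agents have strict incentives (`stable_of_subcritical`).
Above 1, the game has a potential that no move decreases; the alternating eigenvector of the block
is a direction in which it grows, so play started there cannot return
(`not_isAttractive_of_supercritical`).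

The finite set `E` removes `δ = 0`, `δ = 1`, the critical values of blocks that fit in the path, and
ties in (iii). Ties are finite in number because they are roots of a nonzero polynomial
(`finite_setOf_blockSolution_add_eq`). -/

theorem isProbabilityMeasure_updateLaw (hn : 0 < n) : IsProbabilityMeasure (updateLaw n) := by
  have : Nonempty (Fin n) := ⟨⟨0, hn⟩⟩
  have : IsProbabilityMeasure (uniformOn (Set.univ : Set (Fin n))) :=
    isProbabilityMeasure_uniformOn Set.finite_univ Set.univ_nonempty
  unfold updateLaw
  infer_instance

/-- Almost surely, every agent moves infinitely often. -/
theorem updateLaw_frequently_eq_one (hn : 0 < n) :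
    updateLaw n {ω | ∀ i : Fin n, ∃ᶠ t in atTop, ω t = i} = 1 := by
  have := isProbabilityMeasure_updateLaw hn
  have : Nonempty (Fin n) := ⟨⟨0, hn⟩⟩
  have : IsProbabilityMeasure (uniformOn (Set.univ : Set (Fin n))) :=
    isProbabilityMeasure_uniformOn Set.finite_univ Set.univ_nonempty
  have hae : ∀ᵐ ω ∂(updateLaw n), ∀ i : Fin n, ∃ᶠ t in atTop, ω t = i := by
    rw [ae_all_iff]
    intro i
    have hmeas : ∀ t : ℕ, MeasurableSet {ω : ℕ → Fin n | ω t = i} := fun t =>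
      measurableSet_eq_fun (measurable_pi_apply t) measurable_const
    have hval : ∀ t : ℕ, updateLaw n {ω : ℕ → Fin n | ω t = i} =
        uniformOn (Set.univ : Set (Fin n)) {i} := fun t => by
      have := (measurePreserving_eval_infinitePi
        (fun _ : ℕ => uniformOn (Set.univ : Set (Fin n))) t).measure_preimage
        (measurableSet_singleton i).nullMeasurableSet
      exact this
    have hindep : iIndepSet (fun t : ℕ => {ω : ℕ → Fin n | ω t = i}) (updateLaw n) := by
      have h := iIndepFun_infinitePi
        (P := fun _ : ℕ => uniformOn (Set.univ : Set (Fin n))) (X := fun _ x => x)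
        (fun _ => measurable_id)
      rw [iIndepSet_iff_meas_biInter hmeas]
      intro S
      exact h.measure_inter_preimage_eq_mul S (sets := fun _ => {i})
        (fun _ _ => measurableSet_singleton i)
    have hpos : uniformOn (Set.univ : Set (Fin n)) {i} ≠ 0 := by
      rw [uniformOn_univ]
      simp
    -- Second Borel–Cantelli lemma: the moves of `i` are independent events of the same positive
    -- probability.
    have h1 := measure_limsup_eq_one hmeas hindep (by
      simp only [hval]
      exact ENNReal.tsum_const_eq_top_of_ne_zero hpos)
    have h2 := (mem_ae_iff_prob_eq_one₀
      (MeasurableSet.measurableSet_limsup hmeas).nullMeasurableSet).2 h1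
    filter_upwards [h2] with ω hω
    rw [mem_limsup_iff_frequently_mem] at hω
    exact hω
  have h3 : (updateLaw n) {ω | ∀ i : Fin n, ∃ᶠ t in atTop, ω t = i}ᶜ = 0 := hae
  apply le_antisymm prob_le_one
  have h4 := measure_union_le (μ := updateLaw n) {ω | ∀ i : Fin n, ∃ᶠ t in atTop, ω t = i}
    {ω | ∀ i : Fin n, ∃ᶠ t in atTop, ω t = i}ᶜ
  rwa [Set.union_compl_self, h3, add_zero, measure_univ] at h4

variable {G : Matrix (Fin n) (Fin n) ℝ} {δ : ℝ} {x : Fin n → ℝ}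

/-- A move replaces one coordinate by a value that again lies in the box of radius `c`, so the box
is invariant for every order of moves. -/
theorem trajectory_weighted_bound {w : Fin n → ℝ} {ρ c : ℝ} (hρ : ρ ≤ 1) (hc : 0 ≤ c)
    (hw : ∀ i, 0 < w i)
    (H : ∀ y : Fin n → ℝ, (∀ i, |y i - x i| ≤ c * w i) →
      ∀ i, |bestResponse G δ y i - x i| ≤ ρ * c * w i)
    {x₀ : Fin n → ℝ} (h₀ : ∀ i, |x₀ i - x i| ≤ c * w i) (ω : ℕ → Fin n) (t : ℕ) :
    ∀ i, |trajectory G δ x₀ ω t i - x i| ≤ c * w i := by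
  induction t with
  | zero => exact h₀
  | succ t ih =>
    intro i
    rw [trajectory]
    by_cases hi : i = ω t
    · subst hi
      rw [Function.update_self]
      refine (H _ ih _).trans ?_
      have := mul_le_mul_of_nonneg_right hρ (mul_nonneg hc (hw (ω t)).le)
      linarith
    · rw [Function.update_of_ne hi]
      exact ih i

/-- Once play is in the box of radius `ρ ^ m * c₀`, every move puts its coordinate into the box of
radius `ρ ^ (m + 1) * c₀`, where later moves keep it. The smaller box is thus reached when every
agent has moved once more. -/
theorem trajectory_eventually_weighted_bound {w : Fin n → ℝ} {ρ c₀ : ℝ} (hρ0 : 0 ≤ ρ) (hρ : ρ ≤ 1)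
    (hc₀ : 0 ≤ c₀)
    (H : ∀ c, 0 ≤ c → c ≤ c₀ → ∀ y : Fin n → ℝ, (∀ i, |y i - x i| ≤ c * w i) →
      ∀ i, |bestResponse G δ y i - x i| ≤ ρ * c * w i)
    {x₀ : Fin n → ℝ} (h₀ : ∀ i, |x₀ i - x i| ≤ c₀ * w i) (hw : ∀ i, 0 < w i) {ω : ℕ → Fin n}
    (hω : ∀ i : Fin n, ∃ᶠ t in atTop, ω t = i) (m : ℕ) :
    ∀ᶠ t in atTop, ∀ i, |trajectory G δ x₀ ω t i - x i| ≤ ρ ^ m * c₀ * w i := by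
  induction m with
  | zero =>
    filter_upwards with t
    simpa using trajectory_weighted_bound hρ hc₀ hw (H c₀ hc₀ le_rfl) h₀ ω t
  | succ m ih =>
    obtain ⟨T, hT⟩ := eventually_atTop.1 ih
    have hcm : ρ ^ m * c₀ ≤ c₀ := mul_le_of_le_one_left hc₀ (pow_le_one₀ hρ0 hρ)
    have hcm0 : 0 ≤ ρ ^ m * c₀ := by positivity
    have hstep : ∀ t, T ≤ t → ∀ i, |bestResponse G δ (trajectory G δ x₀ ω t) i - x i| ≤
        ρ ^ (m + 1) * c₀ * w i := fun t ht i => by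
      have := H _ hcm0 hcm _ (hT t ht) i
      rwa [← mul_assoc, ← pow_succ'] at this
    rw [eventually_all]
    intro i
    obtain ⟨τ, hτ, hτi⟩ := frequently_atTop.1 (hω i) T
    refine eventually_atTop.2 ⟨τ + 1, fun t ht => ?_⟩
    induction t, ht using Nat.le_induction with
    | base =>
      rw [trajectory, hτi, Function.update_self]
      exact hstep τ hτ i
    | succ t ht iht =>
      rw [trajectory]
      by_cases hi : i = ω t
      · subst hi
        rw [Function.update_self]
        exact hstep t (by omega) _
      · rw [Function.update_of_ne hi]
        exact iht

/-- A best-response map that is a local contraction towards `x` in a weighted sup norm makes `x`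
stable. -/
theorem stable_of_weighted_contraction (hn : 0 < n) {w : Fin n → ℝ} {ρ c₀ : ℝ} (hρ0 : 0 ≤ ρ)
    (hρ : ρ < 1) (hc₀ : 0 < c₀) (hw : ∀ i, 0 < w i)
    (H : ∀ c, 0 ≤ c → c ≤ c₀ → ∀ y : Fin n → ℝ, (∀ i, |y i - x i| ≤ c * w i) →
      ∀ i, |bestResponse G δ y i - x i| ≤ ρ * c * w i) :
    IsLyapunovStable G δ x ∧ IsAttractive G δ x := by
  have := isProbabilityMeasure_updateLaw hn
  have : Nonempty (Fin n) := ⟨⟨0, hn⟩⟩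
  obtain ⟨iB, hiB⟩ := Finite.exists_max w
  obtain ⟨im, him⟩ := Finite.exists_min w
  have hB := hw iB
  have hm := hw im
  have hnear : ∀ {x₀ : Fin n → ℝ} {c : ℝ}, 0 < c → ‖x₀ - x‖ < c * w im →
      ∀ i, |x₀ i - x i| ≤ c * w i := by
    intro x₀ c hc h i
    have h1 := norm_le_pi_norm (x₀ - x) i
    rw [Pi.sub_apply, Real.norm_eq_abs] at h1
    have h2 := mul_le_mul_of_nonneg_left (him i) hc.le
    linarith
  have hnorm : ∀ {y : Fin n → ℝ} {c : ℝ}, 0 ≤ c → (∀ i, |y i - x i| ≤ c * w i) →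
      ‖y - x‖ ≤ c * w iB := by
    intro y c hc h
    rw [pi_norm_le_iff_of_nonneg (by positivity)]
    intro i
    rw [Pi.sub_apply, Real.norm_eq_abs]
    exact (h i).trans (mul_le_mul_of_nonneg_left (hiB i) hc)
  constructor
  · intro ε hε
    have hcpos : 0 < min c₀ (ε / (2 * w iB)) := lt_min hc₀ (by positivity)
    refine ⟨min c₀ (ε / (2 * w iB)) * w im, by positivity, fun x₀ _ hx₀ => ?_⟩
    -- Lyapunov stability holds for every sequence of moves. The bound `ε / 2` keeps the supremum
    -- strictly below `ε`.
    have hall : {ω | (⨆ t : ℕ, ENNReal.ofReal ‖trajectory G δ x₀ ω (t + 1) - x‖)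
        < ENNReal.ofReal ε} = Set.univ := by
      rw [Set.eq_univ_iff_forall]
      intro ω
      refine lt_of_le_of_lt (iSup_le fun t => ENNReal.ofReal_le_ofReal (q := ε / 2) ?_)
        ((ENNReal.ofReal_lt_ofReal_iff hε).2 (by linarith))
      refine (hnorm hcpos.le (trajectory_weighted_bound hρ.le hcpos.le hw
        (H _ hcpos.le (min_le_left _ _)) (hnear hcpos hx₀) ω (t + 1))).trans ?_
      calc min c₀ (ε / (2 * w iB)) * w iB ≤ ε / (2 * w iB) * w iB :=
            mul_le_mul_of_nonneg_right (min_le_right _ _) hB.le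
        _ = ε / 2 := by field_simp
    rw [hall, measure_univ]
  · refine ⟨c₀ * w im, by positivity, fun x₀ _ hx₀ => ?_⟩
    refine le_antisymm prob_le_one ?_
    -- It suffices that convergence holds whenever all agents move infinitely often; monotonicity of
    -- the measure makes a measurability proof for the convergence event unnecessary.
    rw [← updateLaw_frequently_eq_one hn]
    refine measure_mono fun ω hω => ?_
    rw [Set.mem_ofPred_eq, Metric.tendsto_nhds]
    intro e he
    have hlim : Tendsto (fun m : ℕ => ρ ^ m * c₀ * w iB) atTop (𝓝 0) := by
      simpa using ((tendsto_pow_atTop_nhds_zero_of_lt_one hρ0 hρ).mul_const c₀).mul_const (w iB)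
    obtain ⟨m, hme⟩ := (hlim.eventually_lt_const he).exists
    filter_upwards [trajectory_eventually_weighted_bound hρ0 hρ.le hc₀.le H (hnear hc₀ hx₀) hw hω m]
      with t ht
    rw [dist_zero_right, norm_norm, norm_sub_rev]
    exact (hnorm (by positivity) ht).trans_lt hme

theorem abs_sum_mul_sub_le (hG : ∀ i j, 0 ≤ G i j) {y b : Fin n → ℝ} (h : ∀ i, |y i - x i| ≤ b i)
    (i : Fin n) : |∑ j, G i j * y j - ∑ j, G i j * x j| ≤ ∑ j, G i j * b j := by
  rw [← Finset.sum_sub_distrib]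
  refine (Finset.abs_sum_le_sum_abs _ _).trans (Finset.sum_le_sum fun j _ => ?_)
  rw [← mul_sub, abs_mul, abs_of_nonneg (hG i j)]
  exact mul_le_mul_of_nonneg_left (h j) (hG i j)

/-- An equilibrium in which the inactive agents have a strict incentive to be inactive and the
interaction of the active agents is subcritical is stable. -/
theorem stable_of_subcritical (hn : 0 < n) (hδ : 0 ≤ δ) (hG : ∀ i j, 0 ≤ G i j)
    (hx : IsEquilibrium G δ x) (hstrict : ∀ i, ¬ 0 < x i → 1 < δ * ∑ j, G i j * x j)
    {u : Fin n → ℝ} (hu : ∀ i, 0 ≤ u i)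
    (hsub : ∀ i, 0 < x i → δ * ∑ j, G i j * u j < u i) :
    IsLyapunovStable G δ x ∧ IsAttractive G δ x := by
  -- The weights `u` may vanish at some agents. Adding a small constant makes them positive, and the
  -- finitely many strict inequalities survive by continuity.
  obtain ⟨κ, hκ, hκ0⟩ : ∃ κ : ℝ, (∀ i, 0 < x i → δ * ∑ j, G i j * (u j + κ) < u i + κ) ∧ 0 < κ := by
    have h1 : ∀ᶠ κ : ℝ in 𝓝[>] 0, ∀ i, 0 < x i → δ * ∑ j, G i j * (u j + κ) < u i + κ := by
      refine eventually_nhdsWithin_of_eventually_nhds (eventually_all.2 fun i => ?_)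
      by_cases hi : 0 < x i
      · have hl : ContinuousAt (fun κ : ℝ => δ * ∑ j, G i j * (u j + κ)) 0 := by fun_prop
        have hr : ContinuousAt (fun κ : ℝ => u i + κ) 0 := by fun_prop
        filter_upwards [hl.eventually_lt hr (by simpa using hsub i hi)] with κ h _ using h
      · filter_upwards with κ h using absurd h hi
    exact (h1.and self_mem_nhdsWithin).exists
  have hw : ∀ i, 0 < u i + κ := fun i => add_pos_of_nonneg_of_pos (hu i) hκ0
  obtain ⟨ρ, ⟨hρ, hρ1⟩, hρ0⟩ : ∃ ρ : ℝ, ((∀ i, 0 < x i →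
      δ * ∑ j, G i j * (u j + κ) < ρ * (u i + κ)) ∧ ρ < 1) ∧ 0 < ρ := by
    have h1 : ∀ᶠ ρ : ℝ in 𝓝[<] 1, ∀ i, 0 < x i →
        δ * ∑ j, G i j * (u j + κ) < ρ * (u i + κ) := by
      refine eventually_nhdsWithin_of_eventually_nhds (eventually_all.2 fun i => ?_)
      by_cases hi : 0 < x i
      · have hr : ContinuousAt (fun ρ : ℝ => ρ * (u i + κ)) 1 := by fun_prop
        filter_upwards [hr.eventually_const_lt (by simpa using hκ i hi)] with ρ h _ using h
      · filter_upwards with ρ h using absurd h hi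
    exact ((h1.and self_mem_nhdsWithin).and
      (eventually_nhdsWithin_of_eventually_nhds (lt_mem_nhds one_pos))).exists
  -- In a box this small the strict incentives persist, so the best response of an inactive agent is
  -- exactly 0.
  obtain ⟨c₀, hc₀, hc₀0⟩ : ∃ c : ℝ, (∀ i, ¬ 0 < x i →
      1 + c * (δ * ∑ j, G i j * (u j + κ)) < δ * ∑ j, G i j * x j) ∧ 0 < c := by
    have h1 : ∀ᶠ c : ℝ in 𝓝[>] 0, ∀ i, ¬ 0 < x i →
        1 + c * (δ * ∑ j, G i j * (u j + κ)) < δ * ∑ j, G i j * x j := by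
      refine eventually_nhdsWithin_of_eventually_nhds (eventually_all.2 fun i => ?_)
      by_cases hi : 0 < x i
      · filter_upwards with ρ h using absurd hi h
      · have hr : ContinuousAt (fun c : ℝ => 1 + c * (δ * ∑ j, G i j * (u j + κ))) 0 := by fun_prop
        filter_upwards [hr.eventually_lt_const (by simpa using hstrict i hi)] with ρ h _ using h
    exact (h1.and self_mem_nhdsWithin).exists
  refine stable_of_weighted_contraction hn hρ0.le hρ1 hc₀0 hw fun c hc hcc y hy i => ?_
  have hdiff := abs_sum_mul_sub_le hG hy i
  have hsum : ∑ j, G i j * (c * (u j + κ)) = c * ∑ j, G i j * (u j + κ) := by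
    rw [Finset.mul_sum]
    exact Finset.sum_congr rfl fun j _ => by ring
  rw [hsum] at hdiff
  have hS : 0 ≤ ∑ j, G i j * (u j + κ) :=
    Finset.sum_nonneg fun j _ => mul_nonneg (hG i j) (hw j).le
  rw [abs_le] at hdiff
  have hd1 := mul_le_mul_of_nonneg_left hdiff.1 hδ
  have hd2 := mul_le_mul_of_nonneg_left hdiff.2 hδ
  by_cases hi : 0 < x i
  · have hxi := hx.2 i
    have h1 : |bestResponse G δ y i - x i| ≤ δ * (c * ∑ j, G i j * (u j + κ)) := by
      rw [hxi]
      unfold bestResponse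
      rw [max_comm 0, max_comm 0]
      refine (abs_max_sub_max_le_abs _ _ _).trans ?_
      rw [abs_le]
      constructor <;> linarith
    refine h1.trans ?_
    have h2 := mul_le_mul_of_nonneg_left (hρ i hi).le hc
    linarith
  · have hxi : x i = 0 := le_antisymm (not_lt.1 hi) (hx.1 i).1
    have h0 : bestResponse G δ y i = 0 := by
      unfold bestResponse
      refine max_eq_left ?_
      have h3 := hc₀ i hi
      have h4 := mul_le_mul_of_nonneg_right hcc (mul_nonneg hδ hS)
      linarith
    rw [h0, hxi, sub_zero, abs_zero]
    have := hw i
    positivity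

/-! ### The potential of the game -/

/-- The potential of the game with linear best responses. -/
noncomputable def potential (G : Matrix (Fin n) (Fin n) ℝ) (δ : ℝ) (x : Fin n → ℝ) : ℝ :=
  x ⬝ᵥ (fun _ => 1) - x ⬝ᵥ ((1 + δ • G) *ᵥ x) / 2

/-- The potential is quadratic, so its second-order expansion is exact; symmetry of `G` merges the
two cross terms. -/
theorem potential_add (hG : G.IsSymm) (x d : Fin n → ℝ) :
    potential G δ (x + d) = potential G δ x + d ⬝ᵥ ((fun _ => 1) - (1 + δ • G) *ᵥ x)
      - d ⬝ᵥ ((1 + δ • G) *ᵥ d) / 2 := by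
  have hs : (1 + δ • G)ᵀ = 1 + δ • G := by
    rw [transpose_add, transpose_one, transpose_smul, hG.eq]
  have h1 : x ⬝ᵥ ((1 + δ • G) *ᵥ d) = d ⬝ᵥ ((1 + δ • G) *ᵥ x) := by
    rw [dotProduct_mulVec, ← mulVec_transpose, hs, dotProduct_comm]
  unfold potential
  rw [mulVec_add, add_dotProduct, add_dotProduct, dotProduct_add, dotProduct_add, dotProduct_sub, h1]
  ring

theorem one_add_smul_mulVec_apply (G : Matrix (Fin n) (Fin n) ℝ) (δ : ℝ) (x : Fin n → ℝ)
    (i : Fin n) : ((1 + δ • G) *ᵥ x) i = x i + δ * ∑ j, G i j * x j := by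
  rw [add_mulVec, one_mulVec, smul_mulVec, Pi.add_apply, Pi.smul_apply, smul_eq_mul]
  rfl

/-- With zero diagonal the potential is, in `x i` alone, a concave parabola with vertex `1 - δ * ∑
j, G i j * x j`; the best response maximises it on the nonnegative half-line. -/
theorem potential_le_update (hG : G.IsSymm) (hdiag : ∀ i, G i i = 0) (hx : ∀ i, 0 ≤ x i)
    (i : Fin n) :
    potential G δ x ≤ potential G δ (Function.update x i (bestResponse G δ x i)) := by
  have hu : Function.update x i (bestResponse G δ x i) =
      x + Pi.single i (bestResponse G δ x i - x i) := by
    ext j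
    by_cases h : j = i
    · subst h; simp
    · simp [h]
  rw [hu, potential_add hG, single_dotProduct, single_dotProduct, Pi.sub_apply,
    one_add_smul_mulVec_apply, one_add_smul_mulVec_apply]
  have hz : ∑ j, G i j * (Pi.single i (bestResponse G δ x i - x i) : Fin n → ℝ) j = 0 := by
    refine Finset.sum_eq_zero fun j _ => ?_
    by_cases h : j = i
    · subst h; simp [hdiag]
    · simp [h]
  rw [hz, Pi.single_eq_same]
  unfold bestResponse
  have hxi := hx i
  rcases max_cases 0 (1 - δ * ∑ j, G i j * x j) with ⟨h, h'⟩ | ⟨h, -⟩ <;> rw [h]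
  · nlinarith [sq_nonneg (x i), mul_nonneg hxi (sub_nonneg.2 h')]
  · nlinarith [sq_nonneg (1 - δ * ∑ j, G i j * x j - x i)]

theorem trajectory_nonneg {x₀ : Fin n → ℝ} (h₀ : ∀ i, 0 ≤ x₀ i) (ω : ℕ → Fin n) (t : ℕ) :
    ∀ i, 0 ≤ trajectory G δ x₀ ω t i := by
  induction t with
  | zero => exact h₀
  | succ t ih =>
    intro i
    rw [trajectory]
    by_cases hi : i = ω t
    · subst hi
      rw [Function.update_self]
      exact le_max_left _ _
    · rw [Function.update_of_ne hi]
      exact ih i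

theorem potential_le_trajectory (hG : G.IsSymm) (hdiag : ∀ i, G i i = 0) {x₀ : Fin n → ℝ}
    (h₀ : ∀ i, 0 ≤ x₀ i) (ω : ℕ → Fin n) (t : ℕ) :
    potential G δ x₀ ≤ potential G δ (trajectory G δ x₀ ω t) := by
  induction t with
  | zero => exact le_rfl
  | succ t ih =>
    exact ih.trans (potential_le_update hG hdiag (trajectory_nonneg h₀ ω t) (ω t))

/-- If the potential increases to second order in a direction `d` that moves only agents with an
interior activity level, then the equilibrium is not attractive. -/
theorem not_isAttractive_of_direction (hG : G.IsSymm) (hdiag : ∀ i, G i i = 0)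
    (hx : IsEquilibrium G δ x) {d : Fin n → ℝ} (hd : ∀ i, d i ≠ 0 → 0 < x i ∧ x i < 1)
    (hneg : d ⬝ᵥ ((1 + δ • G) *ᵥ d) < 0) : ¬ IsAttractive G δ x := by
  rintro ⟨ε, hε, H⟩
  obtain ⟨η, ⟨hη1, hη2⟩, hη0⟩ : ∃ η : ℝ, ((∀ i, 0 ≤ (x + η • d) i ∧ (x + η • d) i ≤ 1) ∧
      ‖(x + η • d) - x‖ < ε) ∧ 0 < η := by
    have h1 : ∀ᶠ η : ℝ in 𝓝[>] 0, ∀ i, 0 ≤ (x + η • d) i ∧ (x + η • d) i ≤ 1 := by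
      refine eventually_nhdsWithin_of_eventually_nhds (eventually_all.2 fun i => ?_)
      by_cases hi : d i = 0
      · filter_upwards with η
        simpa [hi] using hx.1 i
      · have hc : ContinuousAt (fun η : ℝ => (x + η • d) i) 0 := by
          simp only [Pi.add_apply, Pi.smul_apply]; fun_prop
        filter_upwards [hc.eventually_const_lt (u := 0) (by simpa using (hd i hi).1),
          hc.eventually_lt_const (u := 1) (by simpa using (hd i hi).2)] with η h h'
          using ⟨h.le, h'.le⟩
    have h2 : ∀ᶠ η : ℝ in 𝓝[>] 0, ‖(x + η • d) - x‖ < ε := by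
      refine eventually_nhdsWithin_of_eventually_nhds ?_
      have hc : ContinuousAt (fun η : ℝ => ‖(x + η • d) - x‖) 0 := by fun_prop
      exact hc.eventually_lt_const (by simpa using hε)
    exact ((h1.and h2).and self_mem_nhdsWithin).exists
  have hpot : potential G δ x < potential G δ (x + η • d) := by
    -- No first-order term: `d` lives on active agents, whose best response is not truncated at 0,
    -- so the gradient vanishes there.
    have h0 : d ⬝ᵥ ((fun _ => 1) - (1 + δ • G) *ᵥ x) = 0 := by
      refine Finset.sum_eq_zero fun i _ => ?_
      by_cases hi : d i = 0
      · rw [hi, zero_mul]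
      · rw [Pi.sub_apply, one_add_smul_mulVec_apply]
        have hxi := hx.2 i
        have hp := (hd i hi).1
        unfold bestResponse at hxi
        rcases max_cases 0 (1 - δ * ∑ j, G i j * x j) with ⟨h, _⟩ | ⟨h, _⟩ <;> rw [h] at hxi
        · linarith
        · rw [mul_eq_zero]
          right
          linarith
    rw [potential_add hG, smul_dotProduct, h0, mulVec_smul, smul_dotProduct, dotProduct_smul,
      smul_eq_mul, smul_eq_mul, smul_eq_mul]
    have := mul_pos (mul_pos hη0 hη0) (neg_pos.2 hneg)
    linarith
  have hempty : {ω | Tendsto (fun t : ℕ => ‖x - trajectory G δ (x + η • d) ω t‖) atTop (𝓝 0)} =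
      ∅ := by
    rw [Set.eq_empty_iff_forall_notMem]
    intro ω hω
    rw [Set.mem_ofPred_eq] at hω
    have hlim : Tendsto (fun t : ℕ => trajectory G δ (x + η • d) ω t) atTop (𝓝 x) := by
      rw [tendsto_iff_norm_sub_tendsto_zero]
      simpa only [norm_sub_rev] using hω
    have hcont : Continuous (potential G δ) := by
      unfold potential
      fun_prop
    have := ge_of_tendsto' ((hcont.tendsto x).comp hlim)
      (fun t => potential_le_trajectory hG hdiag (fun i => (hη1 i).1) ω t)
    linarith
  have := H _ hη1 hη2
  rw [hempty, measure_empty] at this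
  exact zero_ne_one this

end Dynamics

/-! ### Path matrix, Perron vectors and the linear system of a block. -/

section Path

/-- The entries of a vector, shifted by one and extended by zero. -/
def pad {n : ℕ} (x : Fin n → ℝ) : ℕ → ℝ
  | 0 => 0
  | j + 1 => if h : j < n then x ⟨j, h⟩ else 0

@[simp]
theorem pad_zero {n : ℕ} (x : Fin n → ℝ) : pad x 0 = 0 := rfl

theorem pad_succ_of_lt {n j : ℕ} (x : Fin n → ℝ) (h : j < n) : pad x (j + 1) = x ⟨j, h⟩ :=
  dif_pos h

@[simp]
theorem pad_succ {n : ℕ} (x : Fin n → ℝ) (i : Fin n) : pad x (i + 1) = x i :=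
  dif_pos i.2

theorem pad_of_lt {n j : ℕ} (x : Fin n → ℝ) (h : n < j) : pad x j = 0 := by
  obtain _ | j := j
  · rfl
  · exact dif_neg (by omega)

theorem pad_nonneg {n : ℕ} {x : Fin n → ℝ} (hx : ∀ i, 0 ≤ x i) (j : ℕ) : 0 ≤ pad x j := by
  obtain _ | j := j
  · rfl
  · rcases Nat.lt_or_ge j n with h | h
    · exact (hx ⟨j, h⟩).trans_eq (pad_succ_of_lt x h).symm
    · exact (pad_of_lt x (by omega)).ge

theorem pathMatrix_apply {n : ℕ} (i j : Fin n) : pathMatrix n i j =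
    (if (j : ℕ) + 1 = i then 1 else 0) + if (j : ℕ) = i + 1 then 1 else 0 := by
  unfold pathMatrix
  rw [SimpleGraph.adjMatrix_apply]
  simp only [SimpleGraph.pathGraph_adj]
  split_ifs <;> first | omega | norm_num

theorem pathMatrix_nonneg {n : ℕ} (i j : Fin n) : 0 ≤ pathMatrix n i j := by
  rw [pathMatrix_apply]
  split_ifs <;> norm_num

theorem pathMatrix_isSymm (n : ℕ) : (pathMatrix n).IsSymm :=
  SimpleGraph.isSymm_adjMatrix _

theorem pathMatrix_diag {n : ℕ} (i : Fin n) : pathMatrix n i i = 0 := by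
  rw [pathMatrix_apply, if_neg (by omega), if_neg (by omega), add_zero]

theorem sum_pathMatrix_mul {n : ℕ} (x : Fin n → ℝ) (i : Fin n) :
    ∑ j, pathMatrix n i j * x j = pad x i + pad x (i + 2) := by
  simp only [pathMatrix_apply, add_mul, ite_mul, one_mul, zero_mul, Finset.sum_add_distrib]
  congr 1
  · obtain ⟨_ | i, hi⟩ := i
    · simp
    · rw [pad_succ_of_lt x (Nat.lt_of_succ_lt hi),
        Finset.sum_eq_single (⟨i, Nat.lt_of_succ_lt hi⟩ : Fin n)]
      · simp
      · intro j _ hj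
        rw [if_neg]
        intro h
        exact hj (Fin.ext (by simpa using h))
      · simp
  · by_cases h : (i : ℕ) + 1 < n
    · rw [pad_succ_of_lt x h, Finset.sum_eq_single (⟨i + 1, h⟩ : Fin n)]
      · simp
      · intro j _ hj
        rw [if_neg]
        intro h'
        exact hj (Fin.ext h')
      · simp
    · rw [pad_of_lt x (by omega)]
      refine Finset.sum_eq_zero fun j _ => ?_
      rw [if_neg (by omega)]

theorem one_add_smul_pathMatrix_mulVec {n : ℕ} (δ : ℝ) (x : Fin n → ℝ) (i : Fin n) :
    ((1 + δ • pathMatrix n) *ᵥ x) i = pad x (i + 1) + δ * (pad x i + pad x (i + 2)) := by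
  rw [one_add_smul_mulVec_apply, sum_pathMatrix_mul, pad_succ]

theorem bestResponse_pathMatrix {n : ℕ} (δ : ℝ) (x : Fin n → ℝ) (i : Fin n) :
    bestResponse (pathMatrix n) δ x i = max 0 (1 - δ * (pad x i + pad x (i + 2))) := by
  rw [bestResponse, sum_pathMatrix_mul]

/-! ### Spectrum of the path -/

/-- The largest eigenvalue of the path with `a` vertices. -/
noncomputable def pathEigenvalue (a : ℕ) : ℝ := 2 * Real.cos (Real.pi / (a + 1))

/-- The entries of the Perron eigenvector of the path with `a` vertices. -/
noncomputable def pathWeight (a j : ℕ) : ℝ := Real.sin (j * (Real.pi / (a + 1)))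

@[simp]
theorem pathWeight_zero (a : ℕ) : pathWeight a 0 = 0 := by
  simp [pathWeight]

@[simp]
theorem pathWeight_last (a : ℕ) : pathWeight a (a + 1) = 0 := by
  have : ((a + 1 : ℕ) : ℝ) * (Real.pi / (a + 1)) = Real.pi := by
    push_cast
    field_simp
  rw [pathWeight, this, Real.sin_pi]

theorem pathWeight_pos {a j : ℕ} (hj : j < a) : 0 < pathWeight a (j + 1) := by
  have ha : (0 : ℝ) < a + 1 := by positivity
  have hj' : ((j + 1 : ℕ) : ℝ) < a + 1 := by exact_mod_cast Nat.succ_lt_succ hj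
  refine Real.sin_pos_of_pos_of_lt_pi (by have := Real.pi_pos; positivity) ?_
  rw [← mul_div_assoc, div_lt_iff₀ ha, mul_comm]
  exact mul_lt_mul_of_pos_left hj' Real.pi_pos

/-- Addition formula for the sine. With the zeros at `0` and `a + 1` it says that the weights form
an eigenvector of the path. -/
theorem pathWeight_add (a j : ℕ) :
    pathWeight a j + pathWeight a (j + 2) = pathEigenvalue a * pathWeight a (j + 1) := by
  unfold pathWeight pathEigenvalue
  set θ := Real.pi / ((a : ℝ) + 1)
  have h1 : ((j : ℕ) : ℝ) * θ = ((j + 1 : ℕ) : ℝ) * θ - θ := by push_cast; ring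
  have h2 : ((j + 2 : ℕ) : ℝ) * θ = ((j + 1 : ℕ) : ℝ) * θ + θ := by push_cast; ring
  rw [h1, h2, Real.sin_sub, Real.sin_add]
  ring

theorem pathEigenvalue_one : pathEigenvalue 1 = 0 := by
  unfold pathEigenvalue
  norm_num [Real.cos_pi_div_two]

theorem pathEigenvalue_pos {a : ℕ} (ha : 2 ≤ a) : 0 < pathEigenvalue a := by
  have ha' : (2 : ℝ) ≤ a := by exact_mod_cast ha
  have hpi := Real.pi_pos
  refine mul_pos two_pos (Real.cos_pos_of_mem_Ioo ⟨?_, ?_⟩)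
  · have : 0 < Real.pi / ((a : ℝ) + 1) := by positivity
    linarith
  · exact div_lt_div_of_pos_left hpi two_pos (by linarith)

theorem lt_neg_one_div_cos_iff {a : ℕ} (ha : 2 ≤ a) (δ : ℝ) :
    δ < -1 / (2 * Real.cos ((a : ℝ) * Real.pi / ((a : ℝ) + 1))) ↔ δ * pathEigenvalue a < 1 := by
  have hang : (a : ℝ) * Real.pi / ((a : ℝ) + 1) = Real.pi - Real.pi / (a + 1) := by
    field_simp
    ring
  rw [hang, Real.cos_pi_sub, mul_neg, neg_div_neg_eq, ← pathEigenvalue,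
    lt_div_iff₀ (pathEigenvalue_pos ha)]

/-- For a kernel vector `v`, take the vertex where `|v i|` is largest relative to the Perron weight.
The equation there gives `|v i| ≤ δ * pathEigenvalue a * |v i|`, which is impossible. -/
theorem det_ne_zero_of_subcritical {δ : ℝ} (hδ : 0 ≤ δ) {a : ℕ} (h : δ * pathEigenvalue a < 1) :
    (1 + δ • pathMatrix a).det ≠ 0 := by
  intro hdet
  obtain ⟨v, hv, hMv⟩ := exists_mulVec_eq_zero_iff.2 hdet
  obtain ⟨i₁, hi₁⟩ := Function.ne_iff.1 hv
  have : Nonempty (Fin a) := ⟨i₁⟩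
  obtain ⟨i₀, hi₀⟩ := Finite.exists_max fun i : Fin a => |v i| / pathWeight a (i + 1)
  set c := |v i₀| / pathWeight a (i₀ + 1) with hc
  have hw : ∀ i : Fin a, 0 < pathWeight a (i + 1) := fun i => pathWeight_pos i.2
  have hcpos : 0 < c := lt_of_lt_of_le (div_pos (abs_pos.2 hi₁) (hw i₁)) (hi₀ i₁)
  have hbound : ∀ j ≤ a + 1, |pad v j| ≤ c * pathWeight a j := by
    intro j hj
    obtain _ | j := j
    · simp
    · rcases Nat.lt_or_ge j a with h' | h'
      · have := hi₀ ⟨j, h'⟩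
        rw [div_le_iff₀ (hw _)] at this
        rwa [pad_succ_of_lt v h']
      · obtain rfl : j = a := by omega
        rw [pad_of_lt v (by omega)]
        simp
  have h0 := congrFun hMv i₀
  rw [one_add_smul_pathMatrix_mulVec, pad_succ, Pi.zero_apply] at h0
  have h1 : |v i₀| ≤ δ * (c * (pathEigenvalue a * pathWeight a (i₀ + 1))) := by
    rw [eq_neg_of_add_eq_zero_left h0, abs_neg, abs_mul, abs_of_nonneg hδ, ← pathWeight_add,
      mul_add]
    have h2 := hbound i₀ (by omega)
    have h3 := hbound (i₀ + 2) (by omega)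
    exact mul_le_mul_of_nonneg_left ((abs_add_le _ _).trans (add_le_add h2 h3)) hδ
  have h4 : |v i₀| = c * pathWeight a (i₀ + 1) := by
    rw [hc, div_mul_cancel₀ _ (hw i₀).ne']
  have h5 := mul_lt_mul_of_pos_right h (mul_pos hcpos (hw i₀))
  linarith

/-! ### The linear system of a block -/

/-- The solution of the linear system for the levels in a block of `a` active agents. -/
noncomputable def blockSolution (δ : ℝ) (a : ℕ) : Fin a → ℝ := (1 + δ • pathMatrix a)⁻¹ *ᵥ fun _ => (1 : ℝ)

theorem pad_blockSolution_eq {δ : ℝ} {a : ℕ} (hdet : (1 + δ • pathMatrix a).det ≠ 0) {j : ℕ}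
    (hj : j < a) : pad (blockSolution δ a) (j + 1) +
      δ * (pad (blockSolution δ a) j + pad (blockSolution δ a) (j + 2)) = 1 := by
  have h := one_add_smul_pathMatrix_mulVec δ (blockSolution δ a) ⟨j, hj⟩
  rw [← h, blockSolution, mulVec_mulVec, mul_nonsing_inv _ hdet.isUnit, one_mulVec]

/-- Uniqueness for the recurrence with zero boundary values. It yields the reflection symmetry, the
uniqueness of the all-active equilibrium and the levels of a block inside a longer path. -/
theorem eq_pad_blockSolution {δ : ℝ} {a : ℕ} (hdet : (1 + δ • pathMatrix a).det ≠ 0) {Z : ℕ → ℝ}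
    (h0 : Z 0 = 0) (hlast : Z (a + 1) = 0)
    (hZ : ∀ j < a, Z (j + 1) + δ * (Z j + Z (j + 2)) = 1) {j : ℕ} (hj : j ≤ a + 1) :
    Z j = pad (blockSolution δ a) j := by
  have hpad : ∀ j ≤ a + 1, pad (fun i : Fin a => Z (i + 1)) j = Z j := by
    intro j hj
    obtain _ | j := j
    · exact h0.symm
    · rcases Nat.lt_or_ge j a with h' | h'
      · exact pad_succ_of_lt _ h'
      · obtain rfl : j = a := by omega
        rw [pad_of_lt _ (by omega), hlast]
  have hM : (1 + δ • pathMatrix a) *ᵥ (fun i : Fin a => Z (i + 1)) = fun _ => 1 := by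
    ext i
    rw [one_add_smul_pathMatrix_mulVec, hpad _ (by omega), hpad _ (by omega), hpad _ (by omega)]
    exact hZ i i.2
  have hz : (fun i : Fin a => Z (i + 1)) = blockSolution δ a := by
    rw [blockSolution, ← hM, mulVec_mulVec, nonsing_inv_mul _ hdet.isUnit, one_mulVec]
  rw [← hz, hpad j hj]

theorem pad_blockSolution_symm {δ : ℝ} {a : ℕ} (hdet : (1 + δ • pathMatrix a).det ≠ 0) :
    pad (blockSolution δ a) a = pad (blockSolution δ a) 1 := by
  refine (eq_pad_blockSolution hdet (Z := fun j => pad (blockSolution δ a) (a + 1 - j)) ?_ ?_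
    (fun j hj => ?_) (j := 1) (by omega))
  · exact pad_of_lt _ (by omega)
  · simp
  · have h := pad_blockSolution_eq hdet (j := a - 1 - j) (by omega)
    rw [show a - 1 - j + 1 = a + 1 - (j + 1) by omega,
      show a - 1 - j = a + 1 - (j + 2) by omega,
      show a + 1 - (j + 2) + 2 = a + 1 - j by omega] at h
    rw [add_comm (pad _ (a + 1 - j))]
    exact h

/-- At positive levels the truncation at 0 is inactive, so all-active equilibria are precisely the
positive solutions of the linear system; the bound by 1 is automatic. -/
theorem endpointActivity_eq {δ : ℝ} (hδ : 0 ≤ δ) {a : ℕ} (ha : 0 < a)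
    (hdet : (1 + δ • pathMatrix a).det ≠ 0) (hpos : ∀ v, 0 < blockSolution δ a v) :
    endpointActivity δ a = pad (blockSolution δ a) 1 := by
  have hnn := pad_nonneg fun i => (hpos i).le
  have hex : IsAllActiveEquilibrium a δ (blockSolution δ a) := by
    refine ⟨⟨fun i => ⟨(hpos i).le, ?_⟩, fun i => ?_⟩, hpos⟩
    · have h := pad_blockSolution_eq hdet i.2
      rw [pad_succ] at h
      have := mul_nonneg hδ (add_nonneg (hnn i) (hnn (i + 2)))
      linarith
    · have h := pad_blockSolution_eq hdet i.2
      rw [pad_succ] at h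
      rw [bestResponse_pathMatrix, max_eq_right] <;> linarith [hpos i]
  have huniq : ∀ y, IsAllActiveEquilibrium a δ y → y = blockSolution δ a := by
    rintro y ⟨⟨_, hy⟩, hy0⟩
    ext i
    rw [← pad_succ y, ← pad_succ (blockSolution δ a)]
    refine eq_pad_blockSolution hdet rfl (pad_of_lt _ (by omega)) (fun j hj => ?_) (by omega)
    have h := hy ⟨j, hj⟩
    have h0 := hy0 ⟨j, hj⟩
    rw [bestResponse_pathMatrix] at h
    rw [pad_succ_of_lt y hj]
    rcases max_cases 0 (1 - δ * (pad y j + pad y (j + 2))) with ⟨h', _⟩ | ⟨h', _⟩ <;>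
      rw [h'] at h <;> linarith
  have hE : 0 < a ∧ ∃! x : Fin a → ℝ, IsAllActiveEquilibrium a δ x := ⟨ha, _, hex, huniq⟩
  rw [endpointActivity, dif_pos hE, huniq _ hE.2.choose_spec.1, pad_succ_of_lt _ ha]

open Polynomial in
/-- For all but finitely many `δ`, the first levels of two blocks do not sum to `1 / δ`. -/
theorem finite_setOf_blockSolution_add_eq (a b : ℕ) :
    {δ : ℝ | δ ≠ 0 ∧ (1 + δ • pathMatrix a).det ≠ 0 ∧ (1 + δ • pathMatrix b).det ≠ 0 ∧
      pad (blockSolution δ a) 1 + pad (blockSolution δ b) 1 = 1 / δ}.Finite := by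
  let A : ∀ m : ℕ, Matrix (Fin m) (Fin m) ℝ[X] := fun m => 1 + (X : ℝ[X]) • (pathMatrix m).map C
  have hA : ∀ (m : ℕ) (δ : ℝ), (evalRingHom δ).mapMatrix (A m) = 1 + δ • pathMatrix m := by
    intro m δ
    ext i j
    by_cases hij : i = j
    · subst hij; simp [A]; exact mul_comm _ _
    · simp [A, hij]; exact mul_comm _ _
  let p : ℕ → ℝ[X] := fun m => (A m).det
  have hp : ∀ (m : ℕ) (δ : ℝ), (p m).eval δ = (1 + δ • pathMatrix m).det := by
    intro m δ
    rw [← hA, ← RingHom.map_det]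
    rfl
  -- Cramer's rule: the first level is a quotient of polynomials in `δ` with denominator `p m`.
  obtain ⟨q, hq⟩ : ∃ q : ℕ → ℝ[X], ∀ (m : ℕ) (δ : ℝ), (1 + δ • pathMatrix m).det ≠ 0 →
      (p m).eval δ * pad (blockSolution δ m) 1 = (q m).eval δ := by
    refine ⟨fun m => if h : 0 < m then ((A m).adjugate *ᵥ fun _ => 1) ⟨0, h⟩ else 0,
      fun m δ hdet => ?_⟩
    dsimp only
    by_cases h : 0 < m
    · rw [dif_pos h, pad_succ_of_lt _ h, hp, blockSolution, inv_def, smul_mulVec, Pi.smul_apply,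
        smul_eq_mul, ← mul_assoc, Ring.mul_inverse_cancel _ hdet.isUnit, one_mul, ← hA,
        ← RingHom.map_adjugate, ← coe_evalRingHom, RingHom.map_mulVec]
      simp [Function.comp_def]
    · rw [dif_neg h, pad_of_lt _ (by omega)]
      simp
  -- At `δ = 0` both determinants are 1, so this polynomial takes the value `-1`.
  have hne : X * (q a * p b + q b * p a) - p a * p b ≠ 0 := by
    intro h
    have h0 := congrArg (Polynomial.eval 0) h
    simp [hp] at h0
  refine (Polynomial.finite_setOfPred_isRoot hne).subset ?_
  rintro δ ⟨hδ, hda, hdb, h⟩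
  have h1 := hq a δ hda
  have h2 := hq b δ hdb
  have h3 : δ * (pad (blockSolution δ a) 1 + pad (blockSolution δ b) 1) = 1 := by
    rw [h, mul_one_div_cancel hδ]
  simp only [Set.mem_ofPred_eq, IsRoot.def, eval_sub, eval_mul, eval_add, eval_X, ← h1, ← h2]
  linear_combination (p a).eval δ * (p b).eval δ * h3

end Path

/-! ### Combinatorics of blocks with one-vertex gaps, and gluing of block vectors. -/

section Tilings

variable {n k : ℕ} {a s : Fin k → ℕ}

/-- Blocks of sizes `a 0, …, a (k - 1)` starting in `s 0, …, s (k - 1)` cover the path with `n`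
vertices up to exactly one vertex between consecutive blocks. -/
structure IsTiling (n : ℕ) (a s : Fin k → ℕ) : Prop where
  pos : 0 < k
  first : ∀ i : Fin k, (i : ℕ) = 0 → s i = 0
  step : ∀ i j : Fin k, (j : ℕ) = i + 1 → s j = s i + a i + 1
  last : ∀ i : Fin k, (i : ℕ) + 1 = k → s i + a i = n

theorem IsTiling.sum_eq (h : IsTiling n a s) : ((∑ i, a i : ℕ) : ℤ) = (n : ℤ) - (k : ℤ) + 1 := by
  let A : ℕ → ℕ := fun j => if h : j < k then a ⟨j, h⟩ else 0
  have hA : ∀ (m : ℕ) (hm : m < k), A m = a ⟨m, hm⟩ := fun m hm => dif_pos hm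
  have hsum : ∑ i, a i = ∑ j ∈ Finset.range k, A j := by
    rw [Finset.sum_range]
    exact Finset.sum_congr rfl fun i _ => (hA i i.2).symm
  have key : ∀ (m : ℕ) (hm : m < k),
      s ⟨m, hm⟩ + a ⟨m, hm⟩ = ∑ j ∈ Finset.range (m + 1), A j + m := by
    intro m
    induction m with
    | zero =>
      intro hm
      rw [h.first _ rfl, Finset.sum_range_one, hA 0 hm, zero_add, add_zero]
    | succ m ih =>
      intro hm
      have h1 := ih (by omega)
      have h2 := h.step ⟨m, by omega⟩ ⟨m + 1, hm⟩ rfl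
      rw [Finset.sum_range_succ, hA _ hm]
      omega
  have hk := h.pos
  have h1 := key (k - 1) (by omega)
  have h2 := h.last ⟨k - 1, by omega⟩ (by simp only; omega)
  rw [Nat.sub_add_cancel hk, ← hsum, h2] at h1
  omega

theorem exists_isTiling (h : ((∑ i, a i : ℕ) : ℤ) = (n : ℤ) - (k : ℤ) + 1) :
    ∃ s, IsTiling n a s := by
  let A : ℕ → ℕ := fun j => if h : j < k then a ⟨j, h⟩ else 0
  have hA : ∀ i : Fin k, A i = a i := fun i => dif_pos i.2
  have hsum : ∑ i, a i = ∑ j ∈ Finset.range k, A j := by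
    rw [Finset.sum_range]
    exact Finset.sum_congr rfl fun i _ => (hA i).symm
  refine ⟨fun i => ∑ j ∈ Finset.range i, (A j + 1), ?_, fun i hi => ?_, fun i j hij => ?_,
    fun i hi => ?_⟩
  -- Without blocks the count would read `0 = n + 1`.
  · rcases Nat.eq_zero_or_pos k with rfl | hk
    · simp at h
      omega
    · exact hk
  · simp [hi]
  · rw [hij, Finset.sum_range_succ, hA, add_assoc]
  · have h1 := Finset.sum_range_succ (fun j => A j + 1) i
    rw [hA, hi, Finset.sum_add_distrib, ← hsum] at h1
    simp only [Finset.sum_const, Finset.card_range, smul_eq_mul, mul_one] at h1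
    omega

theorem IsTiling.separated (h : IsTiling n a s) {i j : Fin k} (hij : i < j) :
    s i + a i < s j := by
  obtain ⟨j, hj⟩ := j
  induction j with
  | zero => exact absurd hij (Nat.not_lt_zero _)
  | succ j ih =>
    have h1 := h.step ⟨j, by omega⟩ ⟨j + 1, hj⟩ rfl
    rcases Nat.lt_or_ge (i : ℕ) j with h' | h'
    · have := ih (by omega) h'
      omega
    · have : i = ⟨j, by omega⟩ := by
        rw [Fin.lt_def] at hij
        exact Fin.ext (by simp only at hij ⊢; omega)
      rw [this]
      omega

theorem IsTiling.le (h : IsTiling n a s) (i : Fin k) : s i + a i ≤ n := by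
  have hk := h.pos
  have hl := h.last ⟨k - 1, by omega⟩ (by simp only; omega)
  by_cases hi : (i : ℕ) + 1 = k
  · exact (h.last i hi).le
  · have := h.separated (i := i) (j := ⟨k - 1, by omega⟩) (by rw [Fin.lt_def]; simp only; omega)
    omega

theorem IsTiling.cover (h : IsTiling n a s) {v : ℕ} (hv : v < n) :
    (∃ i, s i ≤ v ∧ v < s i + a i) ∨
      ∃ i j : Fin k, (j : ℕ) = i + 1 ∧ v = s i + a i ∧ s j = v + 1 := by
  have key : ∀ (m : ℕ) (hm : m < k), v < s ⟨m, hm⟩ + a ⟨m, hm⟩ →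
      (∃ i, s i ≤ v ∧ v < s i + a i) ∨
        ∃ i j : Fin k, (j : ℕ) = i + 1 ∧ v = s i + a i ∧ s j = v + 1 := by
    intro m
    induction m with
    | zero =>
      intro hm hvm
      exact Or.inl ⟨_, by rw [h.first _ rfl]; exact Nat.zero_le _, hvm⟩
    | succ m ih =>
      intro hm hvm
      have h1 := h.step ⟨m, by omega⟩ ⟨m + 1, hm⟩ rfl
      rcases lt_trichotomy v (s ⟨m, by omega⟩ + a ⟨m, by omega⟩) with h' | h' | h'
      · exact ih _ h'
      · exact Or.inr ⟨⟨m, by omega⟩, ⟨m + 1, hm⟩, rfl, h', by omega⟩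
      · exact Or.inl ⟨⟨m + 1, hm⟩, by omega, hvm⟩
  have hk := h.pos
  exact key (k - 1) (by omega) (by
    rw [h.last _ (by simp only; omega)]
    exact hv)

/-! ### Separated blocks -/

/-- The vertex behind a block belongs to no block. -/
theorem not_mem_block_of_eq_end (hsep : ∀ i j, i < j → s i + a i < s j) (i : Fin k) :
    ¬ ∃ j, s j ≤ s i + a i ∧ s i + a i < s j + a j := by
  rintro ⟨j, h1, h2⟩
  rcases lt_trichotomy i j with h | rfl | h
  · have := hsep _ _ h
    omega
  · omega
  · have := hsep _ _ h
    omega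

/-- The vertex in front of a block belongs to no block. -/
theorem not_mem_block_of_succ_eq_start (hsep : ∀ i j, i < j → s i + a i < s j) {i : Fin k} {v : ℕ}
    (hv : s i = v + 1) : ¬ ∃ j, s j ≤ v ∧ v < s j + a j := by
  rintro ⟨j, h1, h2⟩
  rcases lt_trichotomy i j with h | rfl | h
  · have := hsep _ _ h
    omega
  · omega
  · have := hsep _ _ h
    omega

open Classical in
/-- The vector on the path with the levels `Z i 1, …, Z i (a i)` in block `i` and `0` elsewhere. -/
noncomputable def glue (n : ℕ) (a s : Fin k → ℕ) (Z : Fin k → ℕ → ℝ) (v : Fin n) : ℝ :=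
  if h : ∃ i, s i ≤ (v : ℕ) ∧ (v : ℕ) < s i + a i then Z h.choose (v - s h.choose + 1) else 0

/-- The range of `j` includes the two positions bordering the block: they lie in no block or off the
path, where both sides are 0. Three-term relations on a block thus carry over to the glued vector.
-/
theorem pad_glue (hle : ∀ i, s i + a i ≤ n) (hsep : ∀ i j, i < j → s i + a i < s j)
    {Z : Fin k → ℕ → ℝ} (h0 : ∀ i, Z i 0 = 0) (hlast : ∀ i, Z i (a i + 1) = 0) (i : Fin k) {j : ℕ}
    (hj : j ≤ a i + 1) : pad (glue n a s Z) (s i + j) = Z i j := by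
  have hout : ∀ v : ℕ, (¬ ∃ i, s i ≤ v ∧ v < s i + a i) → pad (glue n a s Z) (v + 1) = 0 := by
    intro v hv
    rcases Nat.lt_or_ge v n with h | h
    · rw [pad_succ_of_lt _ h]
      exact dif_neg hv
    · exact pad_of_lt _ (by omega)
  obtain _ | j := j
  · rw [h0, add_zero]
    cases hs : s i with
    | zero => rfl
    | succ v => exact hout v (not_mem_block_of_succ_eq_start hsep hs)
  · rcases Nat.lt_or_ge j (a i) with h | h
    · have hex : ∃ l, s l ≤ s i + j ∧ s i + j < s l + a l := ⟨i, by omega, by omega⟩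
      have huniq : hex.choose = i := by
        obtain ⟨h1, h2⟩ := hex.choose_spec
        rcases lt_trichotomy hex.choose i with h' | h' | h'
        · have := hsep _ _ h'
          omega
        · exact h'
        · have := hsep _ _ h'
          omega
      have hlt : s i + j < n := by have := hle i; omega
      rw [← add_assoc, pad_succ_of_lt _ hlt]
      refine (dif_pos hex).trans ?_
      rw [huniq]
      simp only
      rw [Nat.add_sub_cancel_left]
    · obtain rfl : j = a i := by omega
      rw [hlast, ← add_assoc]
      exact hout _ (not_mem_block_of_eq_end hsep i)

end Tilings

/-! ### Consequences of equilibrium and of attractiveness. -/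

section Necessity

variable {n k : ℕ} {a s : Fin k → ℕ} {δ : ℝ} {x : Fin n → ℝ}

theorem pad_le_one (hx : IsProfile x) (j : ℕ) : pad x j ≤ 1 := by
  obtain _ | j := j
  · exact zero_le_one
  · rcases Nat.lt_or_ge j n with h | h
    · exact (pad_succ_of_lt x h).trans_le (hx _).2
    · exact (pad_of_lt x (by omega)).trans_le zero_le_one

theorem pad_pos_iff (hle : ∀ i, s i + a i ≤ n)
    (hact : ∀ v : Fin n, 0 < x v ↔ ∃ i, s i ≤ (v : ℕ) ∧ (v : ℕ) < s i + a i) (v : ℕ) :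
    0 < pad x (v + 1) ↔ ∃ i, s i ≤ v ∧ v < s i + a i := by
  rcases Nat.lt_or_ge v n with h | h
  · rw [pad_succ_of_lt x h]
    exact hact ⟨v, h⟩
  · rw [pad_of_lt x (by omega)]
    refine iff_of_false (lt_irrefl _) ?_
    rintro ⟨i, _, h2⟩
    have := hle i
    omega

theorem one_le_of_inactive (hx : IsEquilibrium (pathMatrix n) δ x) {v : ℕ} (hv : v < n)
    (h : ¬ 0 < pad x (v + 1)) : 1 ≤ δ * (pad x v + pad x (v + 2)) := by
  have h1 := hx.2 ⟨v, hv⟩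
  rw [pad_succ_of_lt x hv] at h
  rw [bestResponse_pathMatrix] at h1
  have := le_max_right 0 (1 - δ * (pad x v + pad x (v + 2)))
  simp only at h1
  linarith

/-- A single neighbour contributes at most `δ < 1`, while inactivity needs a total of at least 1.
Since `pad` is 0 off the path, this also excludes inactive endpoints. -/
theorem neighbors_pos_of_inactive (hδ0 : 0 ≤ δ) (hδ1 : δ < 1)
    (hx : IsEquilibrium (pathMatrix n) δ x) {v : ℕ} (hv : v < n) (h : ¬ 0 < pad x (v + 1)) :
    0 < pad x v ∧ 0 < pad x (v + 2) := by
  have h1 := one_le_of_inactive hx hv h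
  have hl := mul_le_mul_of_nonneg_left (pad_le_one hx.1 v) hδ0
  have hr := mul_le_mul_of_nonneg_left (pad_le_one hx.1 (v + 2)) hδ0
  constructor <;> exact pos_of_mul_pos_right (a := δ) (by linarith) hδ0

theorem active_eq (hx : IsEquilibrium (pathMatrix n) δ x) {v : ℕ} (h : 0 < pad x (v + 1)) :
    pad x (v + 1) + δ * (pad x v + pad x (v + 2)) = 1 := by
  have hv : v < n := by
    by_contra hv
    rw [pad_of_lt x (by omega)] at h
    exact lt_irrefl _ h
  have h1 := hx.2 ⟨v, hv⟩
  rw [pad_succ_of_lt x hv] at h ⊢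
  rw [bestResponse_pathMatrix] at h1
  simp only at h1
  rcases max_cases 0 (1 - δ * (pad x v + pad x (v + 2))) with ⟨h', _⟩ | ⟨h', _⟩ <;>
    rw [h'] at h1 <;> linarith

theorem isTiling_of_equilibrium (hn : 0 < n) (hδ0 : 0 ≤ δ) (hδ1 : δ < 1)
    (hx : IsEquilibrium (pathMatrix n) δ x) (hle : ∀ i, s i + a i ≤ n)
    (hsep : ∀ i j, i < j → s i + a i < s j)
    (hact : ∀ v : Fin n, 0 < x v ↔ ∃ i, s i ≤ (v : ℕ) ∧ (v : ℕ) < s i + a i) :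
    IsTiling n a s := by
  have hact' := pad_pos_iff hle hact
  have hend : ∀ i, s i + a i < n → ∃ j, s j ≤ s i + a i + 1 ∧ s i + a i + 1 < s j + a j := by
    intro i hi
    rw [← hact']
    exact (neighbors_pos_of_inactive hδ0 hδ1 hx hi
      ((hact' _).not.2 (not_mem_block_of_eq_end hsep i))).2
  obtain ⟨i₀, hi₀, -⟩ : ∃ i, s i ≤ 0 ∧ 0 < s i + a i := by
    rw [← hact']
    by_contra h
    exact lt_irrefl _ (neighbors_pos_of_inactive hδ0 hδ1 hx hn h).1
  refine ⟨i₀.pos, fun i hi => ?_, fun i j hij => ?_, fun i hi => ?_⟩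
  · rcases Nat.lt_or_ge i i₀ with h | h
    · have := hsep i i₀ h
      omega
    · obtain rfl : i = i₀ := Fin.ext (by omega)
      omega
  · have hij' : i < j := by rw [Fin.lt_def]; omega
    have h1 := hsep i j hij'
    have h2 := hle j
    obtain ⟨l, hl1, hl2⟩ := hend i (by omega)
    rcases lt_trichotomy l j with h | rfl | h
    · rcases Nat.lt_or_ge l i with h' | h'
      · have := hsep l i h'
        omega
      · obtain rfl : l = i := Fin.ext (by rw [Fin.lt_def] at h; omega)
        omega
    · omega
    · have := hsep j l h
      omega
  · by_contra hne
    obtain ⟨l, hl1, hl2⟩ := hend i (by have := hle i; omega)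
    rcases Nat.lt_or_ge l i with h' | h'
    · have := hsep l i h'
      omega
    · obtain rfl : l = i := Fin.ext (by omega)
      omega

theorem pad_eq_blockSolution (hx : IsEquilibrium (pathMatrix n) δ x) (hle : ∀ i, s i + a i ≤ n)
    (hsep : ∀ i j, i < j → s i + a i < s j)
    (hact : ∀ v : Fin n, 0 < x v ↔ ∃ i, s i ≤ (v : ℕ) ∧ (v : ℕ) < s i + a i) (i : Fin k)
    (hdet : (1 + δ • pathMatrix (a i)).det ≠ 0) {j : ℕ} (hj : j ≤ a i + 1) :
    pad x (s i + j) = pad (blockSolution δ (a i)) j := by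
  have hact' := pad_pos_iff hle hact
  have hzero : ∀ v, (¬ ∃ i, s i ≤ v ∧ v < s i + a i) → pad x (v + 1) = 0 := fun v hv =>
    le_antisymm (not_lt.1 ((hact' v).not.2 hv)) (pad_nonneg (fun i => (hx.1 i).1) _)
  refine eq_pad_blockSolution hdet (Z := fun j => pad x (s i + j)) ?_ ?_ (fun j hj => ?_) hj
  · simp only [add_zero]
    cases hs : s i with
    | zero => rfl
    | succ v => exact hzero v (not_mem_block_of_succ_eq_start hsep hs)
  · exact hzero _ (not_mem_block_of_eq_end hsep i)
  · exact active_eq hx ((hact' (s i + j)).2 ⟨i, by omega, by omega⟩)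

/-- The eigenvector of a block for the smallest eigenvalue, with alternating signs. -/
noncomputable def alternatingWeight (a s j : ℕ) : ℝ :=
  if s ≤ j ∧ j ≤ s + a + 1 then (-1) ^ j * pathWeight a (j - s) else 0

theorem alternatingWeight_add {a s j : ℕ} (hj : j ≤ a + 1) :
    alternatingWeight a s (s + j) = (-1) ^ (s + j) * pathWeight a j := by
  rw [alternatingWeight, if_pos (by omega), Nat.add_sub_cancel_left]

theorem alternatingWeight_of_notMem {a s v : ℕ} (h : ¬ (s ≤ v ∧ v < s + a)) :
    alternatingWeight a s (v + 1) = 0 := by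
  unfold alternatingWeight
  split_ifs with h'
  · rcases Nat.lt_or_ge v s with h1 | h1
    · rw [show v + 1 - s = 0 by omega, pathWeight_zero, mul_zero]
    · rw [show v + 1 - s = a + 1 by omega, pathWeight_last, mul_zero]
  · rfl

theorem pad_alternatingWeight {a s : ℕ} (hle : s + a ≤ n) (j : ℕ) :
    pad (fun v : Fin n => alternatingWeight a s (v + 1)) j = alternatingWeight a s j := by
  obtain _ | j := j
  · unfold alternatingWeight
    split_ifs <;> simp
  · rcases Nat.lt_or_ge j n with h | h
    · exact pad_succ_of_lt _ h
    · rw [pad_of_lt _ (by omega), alternatingWeight_of_notMem (by omega)]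

/-- On the alternating Perron vector the quadratic form of `1 + δG` is `1 - δ * pathEigenvalue a`
times the squared length, hence negative. -/
theorem not_isAttractive_of_supercritical (hδ : 0 < δ) (hx : IsEquilibrium (pathMatrix n) δ x)
    {a s : ℕ} (hle : s + a ≤ n) (ha : 2 ≤ a)
    (hact : ∀ j < a, 0 < pad x (s + j + 1)) (hsup : 1 < δ * pathEigenvalue a) :
    ¬ IsAttractive (pathMatrix n) δ x := by
  have hnn := pad_nonneg fun i => (hx.1 i).1
  refine not_isAttractive_of_direction (pathMatrix_isSymm n) pathMatrix_diag hx
    (d := fun v : Fin n => alternatingWeight a s (v + 1)) (fun v hv => ?_) ?_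
  · have hmem : s ≤ (v : ℕ) ∧ (v : ℕ) < s + a := by
      by_contra h
      exact hv (alternatingWeight_of_notMem h)
    obtain ⟨j, hj⟩ := Nat.exists_eq_add_of_le hmem.1
    have hv0 : 0 < pad x (v + 1) := by rw [hj]; exact hact j (by omega)
    have heq := active_eq hx hv0
    -- As `2 ≤ a`, every agent of the block has an active neighbour in it, so its level is below 1
    -- and can be perturbed both ways.
    have hnb : 0 < pad x v + pad x (v + 2) := by
      obtain _ | j := j
      · have h1 := hact 1 (by omega)
        rw [show s + 1 + 1 = v + 2 by omega] at h1
        linarith [hnn v]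
      · have h1 := hact j (by omega)
        rw [show s + j + 1 = v by omega] at h1
        linarith [hnn (v + 2)]
    have := mul_pos hδ hnb
    rw [pad_succ] at hv0 heq
    exact ⟨hv0, by linarith⟩
  · have hterm : ∀ v : Fin n, alternatingWeight a s (v + 1) * ((1 + δ • pathMatrix n) *ᵥ
        fun v : Fin n => alternatingWeight a s (v + 1)) v =
        (1 - δ * pathEigenvalue a) * alternatingWeight a s (v + 1) ^ 2 := by
      intro v
      by_cases hmem : s ≤ (v : ℕ) ∧ (v : ℕ) < s + a
      · obtain ⟨j, hj⟩ := Nat.exists_eq_add_of_le hmem.1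
        rw [one_add_smul_pathMatrix_mulVec, pad_alternatingWeight hle, pad_alternatingWeight hle,
          pad_alternatingWeight hle, hj, add_assoc, add_assoc,
          alternatingWeight_add (j := j) (by omega), alternatingWeight_add (j := j + 1) (by omega),
          alternatingWeight_add (j := j + 2) (by omega)]
        have hw := pathWeight_add a j
        linear_combination -((-1 : ℝ) ^ (s + j)) ^ 2 * pathWeight a (j + 1) * δ * hw
      · rw [alternatingWeight_of_notMem hmem]
        ring
    rw [dotProduct, Finset.sum_congr rfl fun v _ => hterm v, ← Finset.mul_sum]
    refine mul_neg_of_neg_of_pos (by linarith) (Finset.sum_pos' (fun v _ => sq_nonneg _)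
      ⟨⟨s, by omega⟩, Finset.mem_univ _, sq_pos_of_ne_zero ?_⟩)
    rw [alternatingWeight_add (by omega)]
    exact mul_ne_zero (pow_ne_zero _ (by norm_num)) (pathWeight_pos (by omega)).ne'

end Necessity

/-! ### Construction of the stable equilibrium. -/

section Sufficiency

variable {n k : ℕ} {a s : Fin k → ℕ} {δ : ℝ}

/-- The block solutions are glued into the equilibrium and the Perron vectors into the weights. Both
vanish at the separators, so blocks do not interact at active agents, and `hgap` is the strict
incentive at each separator. -/
theorem supportsStableEquilibrium_of_isTiling (hn : 0 < n) (hδ : 0 < δ) (hs : IsTiling n a s)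
    (hsub : ∀ i, δ * pathEigenvalue (a i) < 1) (hpos : ∀ i v, 0 < blockSolution δ (a i) v)
    (hgap : ∀ i j : Fin k, (j : ℕ) = i + 1 →
      1 < δ * (pad (blockSolution δ (a i)) (a i) + pad (blockSolution δ (a j)) 1)) :
    SupportsStableEquilibrium n δ a := by
  have hle := hs.le
  have hsep : ∀ i j, i < j → s i + a i < s j := fun i j => hs.separated
  have hdet : ∀ i, (1 + δ • pathMatrix (a i)).det ≠ 0 := fun i =>
    det_ne_zero_of_subcritical hδ.le (hsub i)
  set Y : Fin k → ℕ → ℝ := fun i => pad (blockSolution δ (a i)) with hY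
  have hY0 : ∀ i, Y i 0 = 0 := fun i => rfl
  have hY1 : ∀ i, Y i (a i + 1) = 0 := fun i => pad_of_lt _ (by omega)
  have hYnn : ∀ i j, 0 ≤ Y i j := fun i => pad_nonneg fun v => (hpos i v).le
  have hYpos : ∀ i, ∀ j < a i, 0 < Y i (j + 1) := fun i j hj => by
    rw [hY]
    simp only
    rw [pad_succ_of_lt _ hj]
    exact hpos i _
  set x := glue n a s Y with hxdef
  have hpad : ∀ i j, j ≤ a i + 1 → pad x (s i + j) = Y i j := fun i j hj =>
    pad_glue hle hsep hY0 hY1 i hj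
  have hactive : ∀ {v : Fin n} {i : Fin k}, s i ≤ (v : ℕ) ∧ (v : ℕ) < s i + a i →
      0 < x v ∧ x v + δ * (pad x v + pad x (v + 2)) = 1 ∧ 0 ≤ pad x v + pad x (v + 2) := by
    intro v i hv
    obtain ⟨j, hj⟩ := Nat.exists_eq_add_of_le hv.1
    rw [← pad_succ x v, hj, add_assoc, add_assoc, hpad i j (by omega), hpad i _ (by omega),
      hpad i _ (by omega)]
    exact ⟨hYpos i j (by omega), pad_blockSolution_eq (hdet i) (by omega),
      add_nonneg (hYnn i _) (hYnn i _)⟩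
  have hinactive : ∀ {v : Fin n} {i j : Fin k}, (j : ℕ) = i + 1 → (v : ℕ) = s i + a i →
      s j = v + 1 → x v = 0 ∧ 1 < δ * (pad x v + pad x (v + 2)) := by
    intro v i j hij hv hj
    have h2 : pad x (v + 2) = Y j 1 := by
      rw [← hpad j 1 (by omega), hj]
    rw [h2, ← pad_succ x v, hv, hpad i _ (by omega), add_assoc, hpad i _ le_rfl]
    exact ⟨hY1 i, hgap i j hij⟩
  have hconf : ∀ v : Fin n, 0 < x v ↔ ∃ i, s i ≤ (v : ℕ) ∧ (v : ℕ) < s i + a i := by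
    intro v
    constructor
    · intro hv
      rcases hs.cover v.2 with h | ⟨i, j, hij, hvi, hj⟩
      · exact h
      · exact absurd (hinactive hij hvi hj).1 hv.ne'
    · rintro ⟨i, hi⟩
      exact (hactive hi).1
  have hstrict : ∀ v : Fin n, ¬ 0 < x v → x v = 0 ∧ 1 < δ * (pad x v + pad x (v + 2)) := by
    intro v hv
    rcases hs.cover v.2 with ⟨i, hi⟩ | ⟨i, j, hij, hvi, hj⟩
    · exact absurd (hactive hi).1 hv
    · exact hinactive hij hvi hj
  have heq : IsEquilibrium (pathMatrix n) δ x := by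
    refine ⟨fun v => ?_, fun v => ?_⟩ <;> by_cases hv : 0 < x v
    · obtain ⟨i, hi⟩ := (hconf v).1 hv
      obtain ⟨_, h1, h2⟩ := hactive hi
      exact ⟨hv.le, by linarith [mul_nonneg hδ.le h2]⟩
    · rw [(hstrict v hv).1]
      exact ⟨le_rfl, zero_le_one⟩
    · obtain ⟨i, hi⟩ := (hconf v).1 hv
      obtain ⟨_, h1, _⟩ := hactive hi
      rw [bestResponse_pathMatrix, max_eq_right] <;> linarith
    · obtain ⟨h0, h1⟩ := hstrict v hv
      rw [bestResponse_pathMatrix, max_eq_left (by linarith), h0]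
  set U : Fin k → ℕ → ℝ := fun i => pathWeight (a i) with hU
  have hU0 : ∀ i, U i 0 = 0 := fun i => pathWeight_zero _
  have hU1 : ∀ i, U i (a i + 1) = 0 := fun i => pathWeight_last _
  refine ⟨x, ⟨heq, stable_of_subcritical hn hδ.le pathMatrix_nonneg heq (fun v hv => ?_)
    (u := glue n a s U) (fun v => ?_) (fun v hv => ?_)⟩, s, hle, hsep, hconf⟩
  · rw [sum_pathMatrix_mul]
    exact (hstrict v hv).2
  · rw [← pad_succ (glue n a s U) v]
    rcases hs.cover v.2 with ⟨i, hi⟩ | ⟨i, j, hij, hvi, hj⟩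
    · obtain ⟨j, hj⟩ := Nat.exists_eq_add_of_le hi.1
      rw [hj, add_assoc, pad_glue hle hsep hU0 hU1 i (by omega)]
      exact (pathWeight_pos (by omega)).le
    · rw [hvi, add_assoc, pad_glue hle hsep hU0 hU1 i le_rfl, hU1]
  · obtain ⟨i, hi⟩ := (hconf v).1 hv
    obtain ⟨j, hj⟩ := Nat.exists_eq_add_of_le hi.1
    rw [sum_pathMatrix_mul, ← pad_succ (glue n a s U) v, hj, add_assoc, add_assoc,
      pad_glue hle hsep hU0 hU1 i (by omega), pad_glue hle hsep hU0 hU1 i (by omega),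
      pad_glue hle hsep hU0 hU1 i (by omega), hU]
    simp only
    rw [pathWeight_add]
    have := mul_lt_mul_of_pos_right (hsub i) (pathWeight_pos (a := a i) (j := j) (by omega))
    linarith

end Sufficiency

end NetworkGame

/-! ### The characterisation outside the exceptional set. -/

open NetworkGame in
theorem mainTheorem4 (n : ℕ) (hn : 2 ≤ n) :
    ∃ E : Set ℝ, E.Finite ∧ ∀ δ : ℝ, 0 ≤ δ → δ ≤ 1 → δ ∉ E →
      ∀ (k : ℕ) (a : Fin k → ℕ), (∀ i, 0 < a i) →
        (NetworkGame.SupportsStableEquilibrium n δ a ↔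
          (∀ i, a i ≠ 1 → δ < -1 / (2 * Real.cos ((a i : ℝ) * Real.pi / ((a i : ℝ) + 1)))) ∧
          (∀ i, ∀ v : Fin (a i),
            0 < (((1 : Matrix (Fin (a i)) (Fin (a i)) ℝ) + δ • NetworkGame.pathMatrix (a i))⁻¹ *ᵥ
              (fun _ => (1 : ℝ))) v) ∧
          (∀ i j : Fin k, (j : ℕ) = (i : ℕ) + 1 →
            1 / δ < NetworkGame.endpointActivity δ (a i) + NetworkGame.endpointActivity δ (a j)) ∧
          ((∑ i, a i : ℕ) : ℤ) = (n : ℤ) - (k : ℤ) + 1) := by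
  -- Blocks in the path have at most `n` vertices, so finitely many sizes and pairs of sizes matter.
  refine ⟨{0, 1} ∪ (⋃ m ∈ Finset.range (n + 1), {δ | δ * pathEigenvalue m = 1}) ∪
    ⋃ p ∈ Finset.range (n + 1) ×ˢ Finset.range (n + 1), {δ : ℝ | δ ≠ 0 ∧
      (1 + δ • pathMatrix p.1).det ≠ 0 ∧ (1 + δ • pathMatrix p.2).det ≠ 0 ∧
      pad (blockSolution δ p.1) 1 + pad (blockSolution δ p.2) 1 = 1 / δ}, ?_, ?_⟩
  · refine (((Set.finite_singleton _).insert _).union ?_).union ?_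
    · refine Set.Finite.biUnion (Finset.finite_toSet _) fun m _ => ?_
      exact (Set.finite_singleton (1 / pathEigenvalue m)).subset fun δ hδ =>
        eq_one_div_of_mul_eq_one_left hδ
    · exact Set.Finite.biUnion (Finset.finite_toSet _) fun p _ =>
        finite_setOf_blockSolution_add_eq p.1 p.2
  intro δ hδ0 hδ1 hE k a ha
  simp only [Set.mem_union, Set.mem_insert_iff, Set.mem_singleton_iff, Set.mem_iUnion, not_or,
    not_exists] at hE
  obtain ⟨⟨⟨hne0, hne1⟩, hEev⟩, hEgap⟩ := hE
  have hpos : 0 < δ := lt_of_le_of_ne hδ0 (Ne.symm hne0)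
  have hlt : δ < 1 := lt_of_le_of_ne hδ1 hne1
  have hsub_iff : ∀ i, (a i ≠ 1 →
      δ < -1 / (2 * Real.cos ((a i : ℝ) * Real.pi / ((a i : ℝ) + 1)))) ↔
      δ * pathEigenvalue (a i) < 1 := by
    intro i
    -- A single vertex has eigenvalue 0, so it is subcritical for every `δ`.
    by_cases h : a i = 1
    · rw [h, pathEigenvalue_one, mul_zero]
      exact iff_of_true (fun h' => absurd rfl h') zero_lt_one
    · rw [← lt_neg_one_div_cos_iff (by have := ha i; omega)]
      exact ⟨fun h' => h' h, fun h' _ => h'⟩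
  rw [forall_congr' hsub_iff]
  constructor
  · rintro ⟨x, ⟨heq, -, hattr⟩, s, hle, hsep, hact⟩
    have htil := isTiling_of_equilibrium (by omega) hδ0 hlt heq hle hsep hact
    have hact' := pad_pos_iff hle hact
    have hsub : ∀ i, δ * pathEigenvalue (a i) < 1 := by
      intro i
      by_cases h1 : a i = 1
      · rw [h1, pathEigenvalue_one, mul_zero]
        exact zero_lt_one
      · by_contra hcon
        have hle_i := hle i
        have hne := hEev (a i) (Finset.mem_range.2 (by omega))
        refine not_isAttractive_of_supercritical hpos heq hle_i (by have := ha i; omega)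
          (fun j hj => (hact' _).2 ⟨i, by omega, by omega⟩)
          (lt_of_le_of_ne (not_lt.1 hcon) (Ne.symm hne)) hattr
    have hdet : ∀ i, (1 + δ • pathMatrix (a i)).det ≠ 0 := fun i =>
      det_ne_zero_of_subcritical hδ0 (hsub i)
    have hblock := fun i j hj => pad_eq_blockSolution heq hle hsep hact i (hdet i) (j := j) hj
    have hsol : ∀ i v, 0 < blockSolution δ (a i) v := by
      intro i v
      rw [← pad_succ (blockSolution δ (a i)) v, ← hblock i _ (by omega), ← add_assoc, hact']
      exact ⟨i, by omega, by omega⟩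
    refine ⟨hsub, hsol, fun i j hij => ?_, htil.sum_eq⟩
    have hstep := htil.step i j hij
    have hlei := hle i
    have hlej := hle j
    have haj := ha j
    -- The separator sees the last level of block `i` and the first of block `j`; by reflection the
    -- former is also a first level.
    have hin := one_le_of_inactive heq (v := s i + a i) (by omega)
      ((hact' _).not.2 (not_mem_block_of_eq_end hsep i))
    rw [hblock i _ (by omega), show s i + a i + 2 = s j + 1 by omega, hblock j _ (by omega),
      pad_blockSolution_symm (hdet i)] at hin
    rw [endpointActivity_eq hδ0 (ha i) (hdet i) (hsol i),
      endpointActivity_eq hδ0 (ha j) (hdet j) (hsol j)]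
    -- Equilibrium gives only the weak inequality; equality is excluded by `E`.
    refine lt_of_le_of_ne ?_ ?_
    · rw [div_le_iff₀' hpos]
      exact hin
    · intro h
      exact hEgap (a i, a j) (Finset.mem_product.2 ⟨Finset.mem_range.2 (by simp only; omega),
        Finset.mem_range.2 (by simp only; omega)⟩) ⟨hne0, hdet i, hdet j, h.symm⟩
  · rintro ⟨hsub, hsol, hgap, hsum⟩
    obtain ⟨s, hs⟩ := exists_isTiling hsum
    have hdet : ∀ i, (1 + δ • pathMatrix (a i)).det ≠ 0 := fun i =>
      det_ne_zero_of_subcritical hδ0 (hsub i)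
    refine supportsStableEquilibrium_of_isTiling (by omega) hpos hs hsub hsol fun i j hij => ?_
    have h := hgap i j hij
    rw [endpointActivity_eq hδ0 (ha i) (hdet i) (hsol i),
      endpointActivity_eq hδ0 (ha j) (hdet j) (hsol j), div_lt_iff₀' hpos] at h
    rwa [pad_blockSolution_symm (hdet i)]
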